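/- Let $\Xi=\{x_1,\dots,x_n\}$ be a set of $n$ unknowns. An equation is a pair $E=(u,v)\in\Xi^*\times\Xi^*$; write $|E|=|u|+|v|$ and $|E|_x=|u|_x+|v|_x$, where $|w|$ is the length of the word $w$ and $|w|_c$ is the number of occurrences of the letter $c$ in $w$. A system is a set of equations. A morphism $h:\Xi^*\to\{a_1,\dots,a_r\}^*$ (with any finite number $r$ of letters) is a solution of a system $T$ if $h(u)=h(v)$ for all $(u,v)\in T$. The rank of $h$ is the dimension of the subspace of $\mathbb{Q}^n$ spanned by the vectors $\left(|h(x_1)|_{a_i},\dots,|h(x_n)|_{a_i}\right)$, $1\le i\le r$. A system $T$ in the unknowns $\Xi$ is strongly independent if every proper subsystem of $T$ (including the empty one) has a solution of rank $n-1$ that is not a solution of $T$. **Theorem.** Let $m\ge 1$ and let $T=\{E_1,\dots,E_m\}$ be a strongly independent system of $m$ distinct equations in $n$ unknowns. Then 1. $m\le |E_1|+|E_2|+2$ (if $m\ge 2$), and there are $1\le k<\ell\le n$ such that $m\le 2\left(|E_1|_{x_k}+|E_1|_{x_\ell}\right)+2$. 2. If moreover $T$ has a solution of rank $n-1$, then $m\le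 |E_1|+|E_2|+1$ (if $m\ge 2$), and there are $1\le k<\ell\le n$ such that $m\le 2\left(|E_1|_{x_k}+|E_1|_{x_\ell}\right)+1$. -/

import Mathlib

namespace WordEq

/-- A word equation `(u, v)` in the `n` unknowns `x₁, …, xₙ` (indexed by `Fin n`). -/
abbrev Equation (n : ℕ) : Type := FreeMonoid (Fin n) × FreeMonoid (Fin n)

/-- The number of occurrences `|w|_c` of the letter `c` in the word `w`. -/
def occ {α : Type} [DecidableEq α] (c : α) (w : FreeMonoid α) : ℕ := w.toList.count c

/-- The length `|E| = |u| + |v|` of the equation `E = (u, v)`. -/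
def Equation.size {n : ℕ} (E : Equation n) : ℕ := E.1.length + E.2.length

/-- The number `|E|_x = |u|_x + |v|_x` of occurrences of the unknown `x` in `E = (u, v)`. -/
def Equation.occ {n : ℕ} (E : Equation n) (x : Fin n) : ℕ := WordEq.occ x E.1 + WordEq.occ x E.2

/-- The morphism `h` from words in the `n` unknowns to words over `k` letters solves the system
`T`: `h u = h v` for all `(u, v) ∈ T`. -/
def IsSolution {n k : ℕ} (h : FreeMonoid (Fin n) →* FreeMonoid (Fin k)) (T : Set (Equation n)) :
    Prop :=
  ∀ e ∈ T, h e.1 = h e.2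

/-- The vector `γ(h)_a = (|h(x₁)|_a, …, |h(xₙ)|_a)`, in `ℚⁿ`. -/
def gamma {n k : ℕ} (h : FreeMonoid (Fin n) →* FreeMonoid (Fin k)) (a : Fin k) : Fin n → ℚ :=
  fun x => (occ a (h (FreeMonoid.of x)) : ℚ)

/-- The rank of `h`: the dimension of the subspace of `ℚⁿ` spanned by the vectors `γ(h)_a`. -/
noncomputable def rank {n k : ℕ} (h : FreeMonoid (Fin n) →* FreeMonoid (Fin k)) : ℕ :=
  Module.finrank ℚ (Submodule.span ℚ (Set.range (gamma h)))

/-- The system `T` in `n` unknowns is strongly independent: every proper subsystem (the empty one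
included) has a solution of rank `n - 1`, over some finite alphabet, that does not solve `T`. -/
def StronglyIndependent {n : ℕ} (T : Set (Equation n)) : Prop :=
  ∀ S : Set (Equation n), S ⊂ T →
    ∃ (k : ℕ) (h : FreeMonoid (Fin n) →* FreeMonoid (Fin k)),
      IsSolution h S ∧ rank h + 1 = n ∧ ¬ IsSolution h T

/-- The system `T` in `n` unknowns has a solution of rank `n - 1`, over some finite alphabet. -/
def HasSolutionOfCorank1 {n : ℕ} (T : Set (Equation n)) : Prop :=
  ∃ (k : ℕ) (h : FreeMonoid (Fin n) →* FreeMonoid (Fin k)), IsSolution h T ∧ rank h + 1 = n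

end WordEq

/-!
The proof translates words into polynomials by the Fox calculus. To a word equation `E = (u, v)`
belongs the vector `E.fox` of the differences of the abelianised Fox derivatives of `u` and `v`, with
entries in `ℚ[x₁, …, xₙ]`. By the chain rule, `h` solves `E` if and only if the image of this vector
under `subst h` is orthogonal to certain vectors over the polynomial ring in the letters, one for each
letter (`map_eq_iff`). At `(1, …, 1)` those become the vectors `gamma h a`; so if `h` has rank
`n - 1`, they leave room for one direction only, and the vectors of any two equations that `h` solves
are proportional after `subst h` (`mul_eq_mul_of_orthogonal`). As the kernel of `subst h` depends only
on the hyperplane `gammaSpan h`, two equations with a common solution of rank `n - 1` have the same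
solutions with that hyperplane (`map_eq_of_gammaSpan_eq`).

Let `hᵢ` be a solution of all equations but `Eᵢ`. The hyperplanes of the `hᵢ` for the `m - 2` indices
other than the first two, and that of a solution of the whole system if there is one, are therefore
distinct. All of these morphisms solve `E₁` and `E₂`, so each of them maps each minor
`F = E₁.fox x * E₂.fox y - E₁.fox y * E₂.fox x` to zero; but some `F` is not zero, since some
morphism tells `E₁` and `E₂` apart. It remains to bound the number of hyperplanes in terms of `F`.

Hyperplanes that meet the open positive orthant cut it into more regions than there are hyperplanes
(`exists_separated`). A functional from each region is maximised by a point of the support of `F`.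
Points for different regions are different: a common maximiser would also be the only maximiser of
some functional on a separating hyperplane, so its term would not cancel in `subst h F`. As the
functionals are positive, the points form an antichain (`exists_antichain`). On the other hand, the
exponents of a Fox derivative come from prefixes of one word and form a chain, so the support of `F`
is a union of `2 (|E₁|_x + |E₁|_y)` chains, and likewise for `E₂` (`card_le_of_isAntichain`). The mean
of the two bounds is at most `|E₁| + |E₂|`. A hyperplane that misses the open positive orthant belongs
to a morphism that erases an unknown. There is at most one such hyperplane
(`minor_eq_zero_of_map_eq_one`), which the extra region makes up for.
-/

open MvPolynomial

namespace WordEq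

/-! ### Fox derivatives of words -/

section Fox

variable {α : Type} [DecidableEq α]

/-- The Parikh vector of a word: the exponent vector counting the occurrences of each letter. -/
noncomputable def parikh (w : FreeMonoid α) : α →₀ ℕ :=
  Multiset.toFinsupp (w.toList : Multiset α)

/-- The commutative image of a word, as a monomial. -/
noncomputable def mono (w : FreeMonoid α) : MvPolynomial α ℚ := monomial (parikh w) 1

/-- The recursion that defines `fox`, on lists. -/
noncomputable def foxList (c : α) : List α → MvPolynomial α ℚ
  | [] => 0
  | b :: w => (if b = c then 1 else 0) + X b * foxList c w

/-- The (abelianised) Fox derivative of a word with respect to the letter `c`: the sum of the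
commutative images of the prefixes `p` such that `p c` is again a prefix of the word. -/
noncomputable def fox (c : α) (w : FreeMonoid α) : MvPolynomial α ℚ := foxList c w.toList

theorem parikh_apply (w : FreeMonoid α) (a : α) : parikh w a = occ a w := by
  simp [parikh, occ]

theorem parikh_mul (u v : FreeMonoid α) : parikh (u * v) = parikh u + parikh v := by
  ext a
  simp [parikh_apply, occ]

theorem parikh_of (b : α) : parikh (FreeMonoid.of b) = Finsupp.single b 1 := by
  ext a
  simp [parikh_apply, occ, List.count_singleton, Finsupp.single_apply]

theorem parikh_one : parikh (1 : FreeMonoid α) = 0 := by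
  ext a
  simp [parikh_apply, occ]

theorem eq_one_of_parikh_eq_zero {w : FreeMonoid α} (hw : parikh w = 0) : w = 1 := by
  have h0 : (w.toList : Multiset α) = 0 := by simpa [parikh] using hw
  exact Multiset.coe_eq_zero _ |>.1 h0

theorem mono_mul (u v : FreeMonoid α) : mono (u * v) = mono u * mono v := by
  simp [mono, parikh_mul, monomial_mul]

theorem mono_of (b : α) : mono (FreeMonoid.of b) = X b := by
  simp [mono, parikh_of, X]

theorem mono_one : mono (1 : FreeMonoid α) = 1 := by
  simp [mono, parikh_one]

theorem mono_ne_zero (w : FreeMonoid α) : mono w ≠ 0 := by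
  simp [mono, monomial_eq_zero]

theorem constantCoeff_mono_nonneg (w : FreeMonoid α) : 0 ≤ constantCoeff (mono w) := by
  rw [mono, constantCoeff_monomial]
  split_ifs <;> norm_num

theorem constantCoeff_mono {w : FreeMonoid α} (hw : w ≠ 1) : constantCoeff (mono w) = 0 := by
  rw [mono, constantCoeff_monomial, if_neg fun h => hw (eq_one_of_parikh_eq_zero h)]

theorem fox_one (c : α) : fox c 1 = 0 := rfl

theorem fox_of_mul (c b : α) (w : FreeMonoid α) :
    fox c (FreeMonoid.of b * w) = (if b = c then 1 else 0) + X b * fox c w := rfl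

theorem fox_mul (c : α) (u v : FreeMonoid α) : fox c (u * v) = fox c u + mono u * fox c v := by
  induction u using FreeMonoid.inductionOn' with
  | one => simp [fox_one, mono_one]
  | of_mul b u ih =>
    rw [mul_assoc, fox_of_mul, ih, fox_of_mul, mono_mul, mono_of]
    ring

theorem eval_one_fox (c : α) (w : FreeMonoid α) : eval 1 (fox c w) = occ c w := by
  induction w using FreeMonoid.inductionOn' with
  | one => simp [fox_one, occ]
  | of_mul b w ih =>
    rw [fox_of_mul, map_add, map_mul, ih, eval_X]
    by_cases h : b = c
    · simp [h, occ, add_comm]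
    · simp [h, occ]

theorem constantCoeff_fox_of_mul (c b : α) (w : FreeMonoid α) :
    constantCoeff (fox c (FreeMonoid.of b * w)) = if b = c then 1 else 0 := by
  rw [fox_of_mul, map_add, map_mul, constantCoeff_X, zero_mul, add_zero]
  split_ifs <;> simp

/-- A word is determined by its Fox derivatives. -/
theorem eq_of_fox_eq {u v : FreeMonoid α} (h : ∀ c, fox c u = fox c v) : u = v := by
  induction u using FreeMonoid.inductionOn' generalizing v with
  | one =>
    induction v using FreeMonoid.inductionOn' with
    | one => rfl
    | of_mul b v _ =>
      have := congrArg constantCoeff (h b)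
      simp [constantCoeff_fox_of_mul, fox_one] at this
  | of_mul b u ih =>
    induction v using FreeMonoid.inductionOn' with
    | one =>
      have := congrArg constantCoeff (h b)
      simp [constantCoeff_fox_of_mul, fox_one] at this
    | of_mul b' v _ =>
      have hb : b' = b := by
        have := congrArg constantCoeff (h b)
        rw [constantCoeff_fox_of_mul, constantCoeff_fox_of_mul, if_pos rfl] at this
        by_contra hne
        simp [hne] at this
      subst hb
      congr 1
      refine ih fun c => ?_
      have := h c
      rw [fox_of_mul, fox_of_mul] at this
      exact mul_left_cancel₀ (X_ne_zero b') (add_left_cancel this)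

/-- The fundamental formula of the Fox calculus. -/
theorem sum_fox_mul_X_sub_one [Fintype α] (w : FreeMonoid α) :
    ∑ c, fox c w * (X c - 1) = mono w - 1 := by
  induction w using FreeMonoid.inductionOn' with
  | one => simp [fox_one, mono_one]
  | of_mul b w ih =>
    simp only [fox_of_mul, add_mul, mul_assoc, Finset.sum_add_distrib, ← Finset.mul_sum, ih]
    simp [mono_mul, mono_of]
    ring

theorem coeff_fox_nonneg (c : α) (w : FreeMonoid α) (p : α →₀ ℕ) : 0 ≤ coeff p (fox c w) := by
  induction w using FreeMonoid.inductionOn' generalizing p with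
  | one => simp [fox_one]
  | of_mul b w ih =>
    rw [fox_of_mul, coeff_add, coeff_X_mul']
    refine add_nonneg ?_ ?_
    · split_ifs
      · rw [coeff_one]; split_ifs <;> norm_num
      · simp
    · split_ifs
      · exact ih _
      · exact le_rfl

theorem support_fox_of_mul_subset (c b : α) (w : FreeMonoid α) :
    (fox c (FreeMonoid.of b * w)).support ⊆
      (if b = c then {0} else ∅) ∪
        (fox c w).support.image (fun p => Finsupp.single b 1 + p) := by
  intro p hp
  rw [mem_support_iff, fox_of_mul, coeff_add, coeff_X_mul'] at hp
  by_cases hb : b ∈ p.support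
  · have hle : Finsupp.single b 1 ≤ p := by
      rw [Finsupp.single_le_iff]
      exact Nat.one_le_iff_ne_zero.2 (Finsupp.mem_support_iff.1 hb)
    have h0 : (0 : α →₀ ℕ) ≠ p := by
      rintro rfl
      simp at hb
    have h1 : coeff p (if b = c then 1 else 0 : MvPolynomial α ℚ) = 0 := by
      split_ifs
      · rw [coeff_one, if_neg h0]
      · simp
    rw [h1, if_pos hb, zero_add] at hp
    refine Finset.mem_union_right _ (Finset.mem_image.2 ⟨_, mem_support_iff.2 hp, ?_⟩)
    exact add_tsub_cancel_of_le hle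
  · rw [if_neg hb, add_zero] at hp
    refine Finset.mem_union_left _ ?_
    split_ifs at hp ⊢ with hbc
    · rw [coeff_one] at hp
      by_contra hne
      exact hp (if_neg fun h => hne (by simp [h]))
    · simp at hp

theorem card_support_fox_le (c : α) (w : FreeMonoid α) : (fox c w).support.card ≤ occ c w := by
  induction w using FreeMonoid.inductionOn' with
  | one => simp [fox_one]
  | of_mul b w ih =>
    refine (Finset.card_le_card (support_fox_of_mul_subset c b w)).trans
      ((Finset.card_union_le _ _).trans ?_)
    have h2 := Finset.card_image_le (s := (fox c w).support)
      (f := fun p => Finsupp.single b 1 + p)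
    by_cases h : b = c
    · have : occ c (FreeMonoid.of b * w) = occ c w + 1 := by simp [occ, h]
      rw [if_pos h, Finset.card_singleton]
      omega
    · have : occ c (FreeMonoid.of b * w) = occ c w := by simp [occ, h]
      rw [if_neg h, Finset.card_empty]
      omega

/-- The exponents of a Fox derivative are Parikh vectors of prefixes of one word, so they form a
chain. -/
theorem isChain_support_fox (c : α) (w : FreeMonoid α) :
    IsChain (· ≤ ·) ((fox c w).support : Set (α →₀ ℕ)) := by
  induction w using FreeMonoid.inductionOn' with
  | one => simp [fox_one]
  | of_mul b w ih =>
    have key : ∀ p ∈ (fox c (FreeMonoid.of b * w)).support,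
        p = 0 ∨ ∃ q ∈ (fox c w).support, p = Finsupp.single b 1 + q := by
      intro p hp
      rcases Finset.mem_union.1 (support_fox_of_mul_subset c b w hp) with h | h
      · left
        split_ifs at h
        · simpa using h
        · simp at h
      · right
        obtain ⟨q, hq, rfl⟩ := Finset.mem_image.1 h
        exact ⟨q, hq, rfl⟩
    intro p hp q hq _
    rcases key p hp with rfl | ⟨p', hp', rfl⟩
    · exact Or.inl (zero_le (a := q))
    rcases key q hq with rfl | ⟨q', hq', rfl⟩
    · exact Or.inr (zero_le (a := Finsupp.single b 1 + p'))
    rcases ih.total hp' hq' with h | h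
    · exact Or.inl (add_le_add_right h _)
    · exact Or.inr (add_le_add_right h _)

end Fox

/-! ### Morphisms and the chain rule -/

section Subst

variable {n k : ℕ}

/-- The ring homomorphism between commutative images that the morphism `h` induces. -/
noncomputable def subst (h : FreeMonoid (Fin n) →* FreeMonoid (Fin k)) :
    MvPolynomial (Fin n) ℚ →ₐ[ℚ] MvPolynomial (Fin k) ℚ :=
  aeval fun x => mono (h (FreeMonoid.of x))

/-- The difference of the Fox derivatives of the two sides of an equation. -/
noncomputable def Equation.fox (E : Equation n) (x : Fin n) : MvPolynomial (Fin n) ℚ :=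
  WordEq.fox x E.1 - WordEq.fox x E.2

variable (h : FreeMonoid (Fin n) →* FreeMonoid (Fin k))

theorem subst_X (x : Fin n) : subst h (X x) = mono (h (FreeMonoid.of x)) := by
  simp [subst]

/-- The chain rule of the Fox calculus. -/
theorem fox_map (a : Fin k) (w : FreeMonoid (Fin n)) :
    fox a (h w) = ∑ x, subst h (fox x w) * fox a (h (FreeMonoid.of x)) := by
  induction w using FreeMonoid.inductionOn' with
  | one => simp [fox_one]
  | of_mul b w ih =>
    have hx : ∀ x, subst h (fox x (FreeMonoid.of b * w)) * fox a (h (FreeMonoid.of x)) =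
        (if b = x then fox a (h (FreeMonoid.of x)) else 0) + mono (h (FreeMonoid.of b)) *
          (subst h (fox x w) * fox a (h (FreeMonoid.of x))) := by
      intro x
      rw [fox_of_mul, map_add, map_mul, subst_X]
      split_ifs <;> simp [add_mul, mul_assoc]
    rw [map_mul, fox_mul, ih, Finset.sum_congr rfl fun x _ => hx x, Finset.sum_add_distrib,
      Finset.mul_sum]
    simp

/-- An equation of words becomes a system of linear equations over a polynomial ring. -/
theorem map_eq_iff (E : Equation n) :
    h E.1 = h E.2 ↔ ∀ a, ∑ x, subst h (E.fox x) * fox a (h (FreeMonoid.of x)) = 0 := by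
  have key : ∀ a, ∑ x, subst h (E.fox x) * fox a (h (FreeMonoid.of x)) =
      fox a (h E.1) - fox a (h E.2) := by
    intro a
    rw [fox_map h a E.1, fox_map h a E.2]
    simp [Equation.fox, sub_mul, Finset.sum_sub_distrib]
  simp only [key, sub_eq_zero]
  exact ⟨fun h a => by rw [h], eq_of_fox_eq⟩

theorem eval_one_subst (F : MvPolynomial (Fin n) ℚ) : eval 1 (subst h F) = eval 1 F := by
  have : ((eval (1 : Fin k → ℚ)).comp (subst h).toRingHom) = eval (1 : Fin n → ℚ) := by
    ext x
    · simp
    · simp [subst, mono, eval_monomial]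
  exact congrArg (fun f => f F) this

theorem constantCoeff_subst_fox_nonneg (x : Fin n) (w : FreeMonoid (Fin n)) :
    0 ≤ constantCoeff (subst h (fox x w)) := by
  induction w using FreeMonoid.inductionOn' with
  | one => simp [fox_one]
  | of_mul b w ih =>
    rw [fox_of_mul, map_add, map_mul, subst_X, map_add, map_mul]
    refine add_nonneg ?_ (mul_nonneg (constantCoeff_mono_nonneg _) ih)
    split_ifs <;> simp

/-- The exponent vector of the image of the monomial with exponent vector `p`. -/
noncomputable def expo (p : Fin n →₀ ℕ) : Fin k →₀ ℕ := p.sum fun x m => m • parikh (h (FreeMonoid.of x))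

theorem subst_monomial (p : Fin n →₀ ℕ) (c : ℚ) :
    subst h (monomial p c) = monomial (expo h p) c := by
  rw [subst, aeval_monomial, expo, Finsupp.prod, Finsupp.sum]
  simp only [mono, monomial_pow, one_pow, algebraMap_eq]
  rw [← MvPolynomial.monomial_sum_index]

theorem expo_apply (p : Fin n →₀ ℕ) (a : Fin k) :
    (expo h p a : ℚ) = ∑ x, gamma h a x * p x := by
  rw [expo, Finsupp.sum_fintype _ _ (by simp)]
  simp [gamma, parikh_apply, mul_comm]

theorem coeff_subst (F : MvPolynomial (Fin n) ℚ) (c : Fin k →₀ ℕ) :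
    coeff c (subst h F) = ∑ p ∈ F.support with expo h p = c, coeff p F := by
  conv_lhs => rw [F.as_sum, map_sum, coeff_sum]
  simp only [subst_monomial, coeff_monomial, Finset.sum_filter]

end Subst

/-! ### Hyperplanes and proportional vectors of polynomials -/

section Hyperplane

variable {n k : ℕ}

/-- The span of the vectors `gamma h a`, whose dimension is the rank of `h`. -/
def gammaSpan (h : FreeMonoid (Fin n) →* FreeMonoid (Fin k)) : Submodule ℚ (Fin n → ℚ) :=
  Submodule.span ℚ (Set.range (gamma h))

theorem gamma_mem_gammaSpan (h : FreeMonoid (Fin n) →* FreeMonoid (Fin k)) (a : Fin k) :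
    gamma h a ∈ gammaSpan h :=
  Submodule.subset_span ⟨a, rfl⟩

theorem dotProduct_eq_zero_of_gamma {h : FreeMonoid (Fin n) →* FreeMonoid (Fin k)}
    {d : Fin n → ℚ} (hd : ∀ a, d ⬝ᵥ gamma h a = 0) {v : Fin n → ℚ} (hv : v ∈ gammaSpan h) :
    d ⬝ᵥ v = 0 := by
  induction hv using Submodule.span_induction with
  | mem v hv => obtain ⟨a, rfl⟩ := hv; exact hd a
  | zero => simp
  | add v w _ _ hv hw => rw [dotProduct_add, hv, hw, add_zero]
  | smul c v _ hv => rw [dotProduct_smul, hv, smul_zero]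

theorem mem_iff_dotProduct_eq_zero {V : Submodule ℚ (Fin n → ℚ)}
    (hV : Module.finrank ℚ V + 1 = n) {d : Fin n → ℚ} (hd : d ≠ 0)
    (hdV : ∀ v ∈ V, d ⬝ᵥ v = 0) (v : Fin n → ℚ) : v ∈ V ↔ d ⬝ᵥ v = 0 := by
  have hf : dotProductEquiv ℚ (Fin n) d ≠ 0 := by simpa using hd
  have hker := Module.Dual.finrank_ker_add_one_of_ne_zero hf
  rw [Module.finrank_fintype_fun_eq_card, Fintype.card_fin] at hker
  have hle : V ≤ LinearMap.ker (dotProductEquiv ℚ (Fin n) d) := fun v hv => by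
    simpa using hdV v hv
  have := Submodule.eq_of_le_of_finrank_eq hle (by omega)
  rw [this]
  simp

theorem exists_normal {V : Submodule ℚ (Fin n → ℚ)} (hV : Module.finrank ℚ V + 1 = n) :
    ∃ d : Fin n → ℚ, d ≠ 0 ∧ ∀ v, v ∈ V ↔ d ⬝ᵥ v = 0 := by
  have hlt : V < ⊤ := by
    refine lt_top_iff_ne_top.2 fun h => ?_
    rw [h, finrank_top, Module.finrank_fintype_fun_eq_card, Fintype.card_fin] at hV
    omega
  obtain ⟨f, hf, hle⟩ := Submodule.exists_le_ker_of_lt_top V hlt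
  obtain ⟨d, rfl⟩ := (dotProductEquiv ℚ (Fin n)).surjective f
  have hd : d ≠ 0 := by
    rintro rfl
    simp at hf
  exact ⟨d, hd, mem_iff_dotProduct_eq_zero hV hd fun v hv => by simpa using hle hv⟩

/-- A morphism of corank one that erases `z` has the coordinate hyperplane of `z` as its span. -/
theorem mem_gammaSpan_iff_of_map_eq_one {h : FreeMonoid (Fin n) →* FreeMonoid (Fin k)}
    (hr : rank h + 1 = n) {z : Fin n} (hz : h (FreeMonoid.of z) = 1) (v : Fin n → ℚ) :
    v ∈ gammaSpan h ↔ v z = 0 := by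
  have hd : (Pi.single z 1 : Fin n → ℚ) ≠ 0 := by simp
  rw [mem_iff_dotProduct_eq_zero (V := gammaSpan h) hr hd (fun v hv => dotProduct_eq_zero_of_gamma (fun a => ?_) hv)]
  · simp
  · simp [gamma, hz, occ]

theorem eq_of_map_eq_one {h : FreeMonoid (Fin n) →* FreeMonoid (Fin k)}
    (hr : rank h + 1 = n) {z w : Fin n} (hz : h (FreeMonoid.of z) = 1)
    (hw : h (FreeMonoid.of w) = 1) : z = w := by
  by_contra hne
  have h1 := (mem_gammaSpan_iff_of_map_eq_one hr hz (Pi.single w 1)).2 (by simp [hne])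
  simpa using (mem_gammaSpan_iff_of_map_eq_one hr hw _).1 h1

/-- Two vectors of polynomials that are orthogonal to all the vectors of Fox derivatives of a
morphism of corank one are proportional. The determinant of `n - 1` of these vectors and a vector
normal to `gammaSpan h` does not vanish, because it does not vanish at `(1, …, 1)`. -/
theorem mul_eq_mul_of_orthogonal {h : FreeMonoid (Fin n) →* FreeMonoid (Fin k)}
    (hr : rank h + 1 = n) {A B : Fin n → MvPolynomial (Fin k) ℚ}
    (hA : ∀ a, ∑ x, A x * fox a (h (FreeMonoid.of x)) = 0)
    (hB : ∀ a, ∑ x, B x * fox a (h (FreeMonoid.of x)) = 0) (x y : Fin n) :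
    A x * B y = A y * B x := by
  obtain ⟨d, hd, hdV⟩ := exists_normal (V := gammaSpan h) hr
  obtain ⟨r, f, hr, hf, hspan, hli⟩ : ∃ (r : ℕ) (f : Fin r → Fin n → ℚ), r + 1 = n ∧
      (∀ i, f i ∈ Set.range (gamma h)) ∧ Submodule.span ℚ (Set.range f) = gammaSpan h ∧
      LinearIndependent ℚ f := by
    obtain ⟨f, hf⟩ := Submodule.exists_fun_fin_finrank_span_eq ℚ (Set.range (gamma h))
    exact ⟨_, f, hr, hf⟩
  obtain rfl := hr
  choose a ha using hf
  have hcons : LinearIndependent ℚ (Fin.cons d f : Fin (r + 1) → Fin (r + 1) → ℚ) := by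
    rw [linearIndependent_finCons]
    refine ⟨hli, fun hmem => hd ?_⟩
    have hmem' : d ∈ gammaSpan h := by
      rw [← hspan]
      exact hmem
    exact dotProduct_self_eq_zero.1 ((hdV d).1 hmem')
  let N : Matrix (Fin (r + 1)) (Fin (r + 1)) ℚ := Matrix.of (Fin.cons d f)
  let M : Matrix (Fin (r + 1)) (Fin (r + 1)) (MvPolynomial (Fin k) ℚ) :=
    Matrix.of (Fin.cons (fun x => C (d x)) fun i x => fox (a i) (h (FreeMonoid.of x)))
  have hM1 : (eval (1 : Fin k → ℚ)).mapMatrix M = N := by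
    ext i x
    rw [RingHom.mapMatrix_apply, Matrix.map_apply]
    refine Fin.cases ?_ (fun i => ?_) i
    · simp [M, N]
    · simp [M, N, eval_one_fox, ← ha, gamma]
  have hdet : M.det ≠ 0 := by
    intro h0
    have h1 : (eval (1 : Fin k → ℚ)) M.det = 0 := by rw [h0, map_zero]
    rw [RingHom.map_det, hM1] at h1
    have hN : IsUnit N := Matrix.linearIndependent_rows_iff_isUnit.1 hcons
    rw [Matrix.isUnit_iff_isUnit_det, h1] at hN
    exact not_isUnit_zero hN
  have hzero : ∀ D : Fin (r + 1) → MvPolynomial (Fin k) ℚ,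
      (∀ a, ∑ x, D x * fox a (h (FreeMonoid.of x)) = 0) → ∑ x, D x * C (d x) = 0 → D = 0 := by
    intro D hD hDd
    refine Matrix.eq_zero_of_mulVec_eq_zero hdet ?_
    ext1 i
    refine Fin.cases ?_ (fun i => ?_) i
    · simpa [M, Matrix.mulVec, dotProduct, mul_comm] using hDd
    · simpa [M, Matrix.mulVec, dotProduct, mul_comm] using hD (a i)
  set s := ∑ x, A x * C (d x) with hs
  set t := ∑ x, B x * C (d x) with ht
  have hcomb : ∀ D : Fin (r + 1) → MvPolynomial (Fin k) ℚ,
      ∑ x, (t * A x - s * B x) * D x = t * ∑ x, A x * D x - s * ∑ x, B x * D x := by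
    intro D
    simp only [Finset.mul_sum, ← Finset.sum_sub_distrib]
    exact Finset.sum_congr rfl fun x _ => by ring
  have hAB : (fun x => t * A x - s * B x) = 0 := by
    refine hzero _ (fun a => ?_) ?_
    · rw [hcomb, hA, hB]; ring
    · rw [hcomb, ← hs, ← ht]; ring
  have hprop : ∀ x, t * A x = s * B x := fun x => sub_eq_zero.1 (congrFun hAB x)
  by_cases ht0 : t = 0
  · have hB0 : B = 0 := hzero B hB ht0
    simp [hB0]
  · refine mul_left_cancel₀ ht0 ?_
    linear_combination B y * hprop x - B x * hprop y

theorem expo_eq_iff (h : FreeMonoid (Fin n) →* FreeMonoid (Fin k)) (p q : Fin n →₀ ℕ) :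
    expo h p = expo h q ↔ ∀ v ∈ gammaSpan h, ∑ x, v x * p x = ∑ x, v x * q x := by
  constructor
  · intro hpq v hv
    have := dotProduct_eq_zero_of_gamma (d := fun x => (p x : ℚ) - q x) (fun a => ?_) hv
    · rw [← sub_eq_zero, ← this, dotProduct, ← Finset.sum_sub_distrib]
      exact Finset.sum_congr rfl fun x _ => by ring
    · have ha : (expo h p a : ℚ) = expo h q a := by rw [hpq]
      rw [expo_apply, expo_apply, ← sub_eq_zero] at ha
      rw [← ha, dotProduct, ← Finset.sum_sub_distrib]
      exact Finset.sum_congr rfl fun x _ => by ring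
  · intro hv
    ext a
    have := hv _ (gamma_mem_gammaSpan h a)
    rw [← expo_apply, ← expo_apply] at this
    exact_mod_cast this

/-- The kernel of `subst h` depends only on the span of `h`. -/
theorem subst_eq_zero_of_gammaSpan_eq {k' : ℕ} {h : FreeMonoid (Fin n) →* FreeMonoid (Fin k)}
    {h' : FreeMonoid (Fin n) →* FreeMonoid (Fin k')} (hh : gammaSpan h = gammaSpan h')
    {F : MvPolynomial (Fin n) ℚ} (hF : subst h F = 0) : subst h' F = 0 := by
  ext c
  rw [coeff_subst, coeff_zero]
  by_cases hc : ∃ p, expo h' p = c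
  · obtain ⟨p, rfl⟩ := hc
    rw [← coeff_zero (R := ℚ) (expo h p), ← hF, coeff_subst]
    refine Finset.sum_congr (Finset.filter_congr fun q _ => ?_) fun _ _ => rfl
    rw [expo_eq_iff, expo_eq_iff, hh]
  · push Not at hc
    rw [Finset.filter_false_of_mem fun p _ => hc p, Finset.sum_empty]

/-! ### Equations with a common solution of corank one -/

/-- The vector of Fox derivatives of a nontrivial equation does not vanish under a morphism of
corank one: up to a common prefix, the sides begin with different letters, and only one of these can
be erased. -/
theorem exists_subst_fox_ne_zero {h : FreeMonoid (Fin n) →* FreeMonoid (Fin k)}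
    (hr : rank h + 1 = n) {E : Equation n} (hE : E.1 ≠ E.2) : ∃ x, subst h (E.fox x) ≠ 0 := by
  obtain ⟨u, v⟩ := E
  simp only [Equation.fox] at hE ⊢
  -- a word `b w` against the empty word: its derivative with respect to `b` is positive at `1`
  have hone : ∀ (b : Fin n) (w : FreeMonoid (Fin n)),
      subst h (fox b (FreeMonoid.of b * w)) ≠ 0 := by
    intro b w h0
    have := congrArg (eval 1) h0
    rw [eval_one_subst, eval_one_fox, map_zero] at this
    simp only [occ, FreeMonoid.toList_of_mul, List.count_cons_self, Nat.cast_succ] at this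
    exact (Nat.cast_add_one_pos (α := ℚ) _).ne' this
  -- different first letters: the constant coefficient forces `h` to erase the other letter
  have hone' : ∀ (b c : Fin n) (w w' : FreeMonoid (Fin n)), b ≠ c →
      subst h (fox b (FreeMonoid.of b * w) - fox b (FreeMonoid.of c * w')) = 0 →
      h (FreeMonoid.of c) = 1 := by
    intro b c w w' hbc h0
    by_contra hc
    have := congrArg constantCoeff h0
    rw [fox_of_mul, fox_of_mul, if_pos rfl, if_neg hbc.symm, zero_add] at this
    simp only [map_sub, map_add, map_mul, subst_X, map_one, map_zero, constantCoeff_mono hc,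
      zero_mul, sub_zero] at this
    have h1 := mul_nonneg (constantCoeff_mono_nonneg (h (FreeMonoid.of b)))
      (constantCoeff_subst_fox_nonneg h b w)
    linarith
  induction u using FreeMonoid.inductionOn' generalizing v with
  | one =>
    induction v using FreeMonoid.inductionOn' with
    | one => exact absurd rfl hE
    | of_mul c v _ => exact ⟨c, by simpa [fox_one] using hone c v⟩
  | of_mul b u ih =>
    induction v using FreeMonoid.inductionOn' with
    | one => exact ⟨b, by simpa [fox_one] using hone b u⟩
    | of_mul c v _ =>
      by_cases hbc : b = c
      · subst hbc
        obtain ⟨x, hx⟩ := ih v fun huv => hE (by rw [huv])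
        refine ⟨x, ?_⟩
        rw [fox_of_mul, fox_of_mul, add_sub_add_left_eq_sub, ← mul_sub, map_mul, subst_X]
        exact mul_ne_zero (mono_ne_zero _) hx
      · by_contra! hall
        refine hbc (eq_of_map_eq_one hr ?_ (hone' b c u v hbc (hall b)))
        refine hone' c b v u (Ne.symm hbc) ?_
        rw [← neg_sub, map_neg, hall c, neg_zero]

/-- If the vectors of Fox derivatives of two equations are proportional under a solution of corank one of
the first one, then it solves the second one too. -/
theorem map_eq_of_proportional {h : FreeMonoid (Fin n) →* FreeMonoid (Fin k)}
    (hr : rank h + 1 = n) {E E' : Equation n} (hE : E.1 ≠ E.2) (hsol : h E.1 = h E.2)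
    (hprop : ∀ x y, subst h (E.fox x * E'.fox y - E.fox y * E'.fox x) = 0) :
    h E'.1 = h E'.2 := by
  obtain ⟨y, hy⟩ := exists_subst_fox_ne_zero hr hE
  rw [map_eq_iff] at hsol ⊢
  intro a
  refine (mul_eq_zero.1 ?_).resolve_left hy
  rw [← mul_zero (subst h (E'.fox y)), ← hsol a, Finset.mul_sum, Finset.mul_sum]
  refine Finset.sum_congr rfl fun x _ => ?_
  have := hprop x y
  rw [map_sub, map_mul, map_mul] at this
  linear_combination -fox a (h (FreeMonoid.of x)) * this

theorem subst_minor_eq_zero {h : FreeMonoid (Fin n) →* FreeMonoid (Fin k)}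
    (hr : rank h + 1 = n) {E E' : Equation n} (hE : h E.1 = h E.2) (hE' : h E'.1 = h E'.2)
    (x y : Fin n) : subst h (E.fox x * E'.fox y - E.fox y * E'.fox x) = 0 := by
  rw [map_sub, map_mul, map_mul, sub_eq_zero]
  exact mul_eq_mul_of_orthogonal hr ((map_eq_iff h E).1 hE) ((map_eq_iff h E').1 hE') x y

/-- Among the morphisms of corank one with a given span, two nontrivial equations that have a
common solution have the same solutions. -/
theorem map_eq_of_gammaSpan_eq {k' : ℕ} {h : FreeMonoid (Fin n) →* FreeMonoid (Fin k)}
    {h' : FreeMonoid (Fin n) →* FreeMonoid (Fin k')} (hr : rank h + 1 = n)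
    (hr' : rank h' + 1 = n) (hh : gammaSpan h = gammaSpan h') {E E' : Equation n}
    (hE : E.1 ≠ E.2) (h1 : h E.1 = h E.2) (h2 : h E'.1 = h E'.2) (h3 : h' E.1 = h' E.2) :
    h' E'.1 = h' E'.2 :=
  map_eq_of_proportional hr' hE h3 fun x y =>
    subst_eq_zero_of_gammaSpan_eq hh (subst_minor_eq_zero hr h1 h2 x y)

end Hyperplane

/-! ### Positive functionals separated by hyperplanes -/

section Regions

open Filter Topology

variable {n : ℕ}

theorem eventually_mul_pos {a : ℚ} (ha : a ≠ 0) (b : ℚ) :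
    ∀ᶠ ε in 𝓝[>] (0 : ℚ), 0 < a * (a + ε * b) := by
  have hc : Tendsto (fun ε : ℚ => a * (a + ε * b)) (𝓝[>] 0) (𝓝 (a * (a + 0 * b))) :=
    Continuous.continuousWithinAt (by fun_prop)
  refine hc.eventually (lt_mem_nhds ?_)
  rw [zero_mul, add_zero]
  exact mul_self_pos.2 ha

/-- Moving slightly off `c` in the direction `e` preserves positivity and the nonzero signs at the
vectors of `W`, and makes nonzero all values at vectors of `W` where `e` does not vanish. -/
theorem eventually_perturb (c e : Fin n → ℚ) (W : Finset (Fin n → ℚ)) :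
    ∀ᶠ ε in 𝓝[>] (0 : ℚ), ((∀ x, 0 < c x) → ∀ x, 0 < (c + ε • e) x) ∧
      ∀ w ∈ W, (c ⬝ᵥ w ≠ 0 → 0 < (c ⬝ᵥ w) * ((c + ε • e) ⬝ᵥ w)) ∧
        (e ⬝ᵥ w ≠ 0 → (c + ε • e) ⬝ᵥ w ≠ 0) := by
  refine Filter.Eventually.and ?_ ((Filter.eventually_all_finset W).2 fun w _ => ?_)
  · by_cases hc : ∀ x, 0 < c x
    · have : ∀ᶠ ε in 𝓝[>] (0 : ℚ), ∀ x, 0 < c x * (c x + ε * e x) :=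
        eventually_all.2 fun x => eventually_mul_pos (hc x).ne' _
      filter_upwards [this] with ε hε _ x
      simpa using pos_of_mul_pos_right (hε x) (hc x).le
    · exact Eventually.of_forall fun ε h => absurd h hc
  · by_cases hc : c ⬝ᵥ w = 0
    · filter_upwards [self_mem_nhdsWithin] with ε hε
      refine ⟨fun h => absurd hc h, fun he => ?_⟩
      rw [add_dotProduct, hc, zero_add, smul_dotProduct, smul_eq_mul]
      exact mul_ne_zero (ne_of_gt hε) he
    · filter_upwards [eventually_mul_pos hc (e ⬝ᵥ w)] with ε hε
      rw [add_dotProduct, smul_dotProduct, smul_eq_mul]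
      exact ⟨fun _ => hε, fun _ => right_ne_zero_of_mul hε.ne'⟩

/-- A subspace is not covered by finitely many hyperplanes that do not contain it. -/
theorem exists_mem_forall_dotProduct_ne_zero (V : Submodule ℚ (Fin n → ℚ))
    (W : Finset (Fin n → ℚ)) (hW : ∀ w ∈ W, ∃ v ∈ V, v ⬝ᵥ w ≠ 0) :
    ∃ v ∈ V, ∀ w ∈ W, v ⬝ᵥ w ≠ 0 := by
  classical
  induction W using Finset.induction_on with
  | empty => exact ⟨0, V.zero_mem, by simp⟩
  | insert w W _ ih =>
    obtain ⟨v, hv, hvW⟩ := ih fun w hw => hW w (Finset.mem_insert_of_mem hw)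
    obtain ⟨e, he, hew⟩ := hW w (Finset.mem_insert_self _ _)
    obtain ⟨ε, -, hε⟩ := (eventually_perturb v e (insert w W)).exists
    refine ⟨v + ε • e, V.add_mem hv (V.smul_mem _ he), fun w' hw' => ?_⟩
    rcases Finset.mem_insert.1 hw' with rfl | hw''
    · exact (hε w' hw').2 hew
    · exact right_ne_zero_of_mul ((hε w' hw').1 (hvW w' hw'')).ne'

/-- Distinct hyperplanes that meet the open positive orthant cut it into more regions than there
are hyperplanes: positive functionals can be chosen from distinct regions, and generic. -/
theorem exists_separated {ι : Type*} [DecidableEq ι] (d : ι → Fin n → ℚ)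
    (W : Finset (Fin n → ℚ)) (hW : ∀ w ∈ W, w ≠ 0) (J : Finset ι)
    (hpos : ∀ j ∈ J, ∃ c : Fin n → ℚ, (∀ x, 0 < c x) ∧ c ⬝ᵥ d j = 0)
    (hne : ∀ i ∈ J, ∀ j ∈ J, i ≠ j → ∃ v, v ⬝ᵥ d j = 0 ∧ v ⬝ᵥ d i ≠ 0)
    (hdW : ∀ j ∈ J, d j ∈ W) :
    ∃ M : Finset (Fin n → ℚ), M.card = J.card + 1 ∧
      (∀ μ ∈ M, (∀ x, 0 < μ x) ∧ ∀ w ∈ W, μ ⬝ᵥ w ≠ 0) ∧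
      ∀ μ ∈ M, ∀ ν ∈ M, μ ≠ ν → ∃ j ∈ J, (μ ⬝ᵥ d j) * (ν ⬝ᵥ d j) < 0 := by
  obtain ⟨e, -, he⟩ := exists_mem_forall_dotProduct_ne_zero ⊤ W fun w hw =>
    ⟨w, trivial, fun h => hW w hw (dotProduct_self_eq_zero.1 h)⟩
  induction J using Finset.induction_on with
  | empty =>
    obtain ⟨ε, hε, hεW⟩ := (eventually_perturb 1 e W).exists
    refine ⟨{1 + ε • e}, rfl, ?_, ?_⟩
    · intro μ hμ
      obtain rfl := Finset.mem_singleton.1 hμ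
      exact ⟨hε fun x => one_pos, fun w hw => (hεW w hw).2 (he w hw)⟩
    · intro μ hμ ν hν hμν
      exact absurd ((Finset.mem_singleton.1 hμ).trans (Finset.mem_singleton.1 hν).symm) hμν
  | insert j J hj ih =>
    have hJ : ∀ {i}, i ∈ J → i ∈ insert j J := Finset.mem_insert_of_mem
    have hjj : j ∈ insert j J := Finset.mem_insert_self _ _
    obtain ⟨M, hcard, hM, hsep⟩ := ih (fun i hi => hpos i (hJ hi))
      (fun i hi i' hi' => hne i (hJ hi) i' (hJ hi')) fun i hi => hdW i (hJ hi)
    -- a positive functional on the new hyperplane and on none of the others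
    obtain ⟨c, hc, hcj, hci⟩ : ∃ c : Fin n → ℚ, (∀ x, 0 < c x) ∧ c ⬝ᵥ d j = 0 ∧
        ∀ i ∈ J, c ⬝ᵥ d i ≠ 0 := by
      obtain ⟨c, hc, hcj⟩ := hpos j hjj
      obtain ⟨v, hv, hvW⟩ := exists_mem_forall_dotProduct_ne_zero
        (LinearMap.ker (dotProductEquiv ℚ (Fin n) (d j))) (J.image d) (fun w hw => by
          obtain ⟨i, hi, rfl⟩ := Finset.mem_image.1 hw
          obtain ⟨v, hv, hvi⟩ := hne i (hJ hi) j hjj (by rintro rfl; exact hj hi)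
          exact ⟨v, by simpa [dotProduct_comm] using hv, hvi⟩)
      obtain ⟨ε, hε, hεW⟩ := (eventually_perturb c v (J.image d)).exists
      refine ⟨c + ε • v, hε hc, ?_, fun i hi => ?_⟩
      · have hv' : v ⬝ᵥ d j = 0 := by simpa [dotProduct_comm] using hv
        rw [add_dotProduct, hcj, smul_dotProduct, hv', smul_zero, add_zero]
      · have := Finset.mem_image_of_mem d hi
        exact (hεW _ this).2 (hvW _ this)
    obtain ⟨ε, ⟨hp, hpW⟩, ⟨hm, hmW⟩, hε⟩ := ((eventually_perturb c e W).and
      ((eventually_perturb c (-e) W).and self_mem_nhdsWithin)).exists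
    have hε : 0 < ε := hε
    -- of the two nearby functionals, on either side of the new hyperplane, at most one is in the
    -- region of a functional chosen before
    obtain ⟨ν, hν, hνM⟩ : ∃ ν : Fin n → ℚ, ((∀ x, 0 < ν x) ∧ ∀ w ∈ W, ν ⬝ᵥ w ≠ 0) ∧
        ∀ μ ∈ M, ∃ i ∈ insert j J, (μ ⬝ᵥ d i) * (ν ⬝ᵥ d i) < 0 := by
      by_contra! hno
      have hW' : ∀ w ∈ W, (-e) ⬝ᵥ w ≠ 0 := fun w hw => by
        rw [neg_dotProduct]; exact neg_ne_zero.2 (he w hw)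
      obtain ⟨μ₁, hμ₁, h₁⟩ := hno (c + ε • e) ⟨hp hc, fun w hw => (hpW w hw).2 (he w hw)⟩
      obtain ⟨μ₂, hμ₂, h₂⟩ := hno (c + ε • -e) ⟨hm hc, fun w hw => (hmW w hw).2 (hW' w hw)⟩
      by_cases hμ : μ₁ = μ₂
      · subst hμ
        have h1 := h₁ j hjj
        have h2 := h₂ j hjj
        rw [add_dotProduct, hcj, zero_add, smul_dotProduct, smul_eq_mul] at h1 h2
        rw [neg_dotProduct] at h2
        have h3 := (hM μ₁ hμ₁).2 _ (hdW j hjj)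
        have h4 := he _ (hdW j hjj)
        have h5 : (μ₁ ⬝ᵥ d j) * (ε * (e ⬝ᵥ d j)) = 0 := le_antisymm (by linarith) h1
        exact mul_ne_zero h3 (mul_ne_zero hε.ne' h4) h5
      · obtain ⟨i, hi, hneg⟩ := hsep μ₁ hμ₁ μ₂ hμ₂ hμ
        have h1 := h₁ i (hJ hi)
        have h2 := h₂ i (hJ hi)
        have h3 := (hpW _ (hdW i (hJ hi))).1 (hci i hi)
        have h4 := (hmW _ (hdW i (hJ hi))).1 (hci i hi)
        have h5 := mul_nonneg h1 h2
        have h6 := mul_pos h3 h4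
        have h7 : 0 < ((c + ε • e) ⬝ᵥ d i) * ((c + ε • -e) ⬝ᵥ d i) := by
          refine pos_of_mul_pos_right (a := (c ⬝ᵥ d i) * (c ⬝ᵥ d i)) ?_ (mul_self_nonneg _)
          linarith
        have h8 := mul_neg_of_neg_of_pos hneg h7
        linarith
    have hνnot : ν ∉ M := fun hmem => by
      obtain ⟨i, _, hi⟩ := hνM ν hmem
      exact absurd (mul_self_nonneg _) hi.not_ge
    refine ⟨insert ν M, ?_, ?_, ?_⟩
    · rw [Finset.card_insert_of_notMem hνnot, Finset.card_insert_of_notMem hj, hcard]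
    · exact (Finset.forall_mem_insert ν M _).2 ⟨hν, hM⟩
    · intro μ hμ μ' hμ' hμμ
      rcases Finset.mem_insert.1 hμ with rfl | hμM <;>
        rcases Finset.mem_insert.1 hμ' with rfl | hμM'
      · exact absurd rfl hμμ
      · obtain ⟨i, hi, h⟩ := hνM _ hμM'
        exact ⟨i, hi, by rwa [mul_comm]⟩
      · exact hνM _ hμM
      · obtain ⟨i, hi, h⟩ := hsep _ hμM _ hμM' hμμ
        exact ⟨i, hJ hi, h⟩

/-- The exponent vector `p` as a vector of rational numbers. -/
def toRat (p : Fin n →₀ ℕ) : Fin n → ℚ := fun x => p x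

/-- A finite set of exponent vectors in which no point is alone in its coset modulo `V`, for each
`V` out of a finite set of hyperplanes that meet the open positive orthant, contains an
antichain with more points than there are hyperplanes. It consists of points that maximise a
positive functional; a point cannot do so for functionals on both sides of a hyperplane. -/
theorem exists_antichain (T : Finset (Fin n →₀ ℕ)) (hT : T.Nonempty)
    (S : Finset (Submodule ℚ (Fin n → ℚ))) (hS : ∀ V ∈ S, Module.finrank ℚ V + 1 = n)
    (hpos : ∀ V ∈ S, ∃ c ∈ V, ∀ x, 0 < c x)
    (hfib : ∀ V ∈ S, ∀ p ∈ T, ∃ q ∈ T, q ≠ p ∧ ∀ v ∈ V, v ⬝ᵥ toRat p = v ⬝ᵥ toRat q) :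
    ∃ M ⊆ T, M.card = S.card + 1 ∧ IsAntichain (· ≤ ·) (M : Set (Fin n →₀ ℕ)) := by
  classical
  have hd : ∀ V : Submodule ℚ (Fin n → ℚ), ∃ d : Fin n → ℚ, V ∈ S →
      d ≠ 0 ∧ ∀ v, v ∈ V ↔ d ⬝ᵥ v = 0 := by
    intro V
    by_cases hV : V ∈ S
    · obtain ⟨d, hd⟩ := exists_normal (hS V hV)
      exact ⟨d, fun _ => hd⟩
    · exact ⟨0, fun h => absurd h hV⟩
  choose d hd using hd
  have hmem : ∀ V ∈ S, ∀ v, v ∈ V ↔ v ⬝ᵥ d V = 0 := fun V hV v => by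
    rw [(hd V hV).2, dotProduct_comm]
  have hinj : ∀ p q : Fin n →₀ ℕ, toRat p - toRat q = 0 → p = q := by
    intro p q h
    ext x
    have := congrFun (sub_eq_zero.1 h) x
    exact Nat.cast_injective (R := ℚ) this
  obtain ⟨M, hcard, hM, hsep⟩ := exists_separated d
    (((T ×ˢ T).image (fun z => toRat z.1 - toRat z.2) ∪ S.image d).filter (· ≠ 0))
    (fun w hw => (Finset.mem_filter.1 hw).2) S
    (fun V hV => by
      obtain ⟨c, hcV, hc⟩ := hpos V hV
      exact ⟨c, hc, (hmem V hV c).1 hcV⟩)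
    (fun U hU V hV hUV => by
      by_contra! hno
      refine hUV (Submodule.eq_of_le_of_finrank_eq (fun v hv => ?_) ?_).symm
      · exact (hmem U hU v).2 (hno v ((hmem V hV v).1 hv))
      · have := hS U hU
        have := hS V hV
        omega)
    (fun V hV => Finset.mem_filter.2
      ⟨Finset.mem_union_right _ (Finset.mem_image_of_mem d hV), (hd V hV).1⟩)
  have hmax : ∀ μ : Fin n → ℚ, ∃ p ∈ T, ∀ q ∈ T, μ ⬝ᵥ toRat q ≤ μ ⬝ᵥ toRat p := fun μ =>
    T.exists_max_image _ hT
  choose f hfT hf using hmax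
  have hlt : ∀ μ ∈ M, ∀ q ∈ T, q ≠ f μ → μ ⬝ᵥ toRat q < μ ⬝ᵥ toRat (f μ) := by
    intro μ hμ q hq hne
    refine lt_of_le_of_ne (hf μ q hq) fun heq => ?_
    refine (hM μ hμ).2 (toRat q - toRat (f μ)) (Finset.mem_filter.2
      ⟨Finset.mem_union_left _ (Finset.mem_image.2 ⟨(q, f μ), ?_, rfl⟩), fun h => hne ?_⟩) ?_
    · exact Finset.mem_product.2 ⟨hq, hfT μ⟩
    · exact hinj _ _ h
    · rw [dotProduct_sub, heq, sub_self]
  have hfinj : Set.InjOn f M := by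
    intro μ hμ ν hν hμν
    by_contra hne
    obtain ⟨V, hV, hneg⟩ := hsep μ hμ ν hν hne
    -- the positive combination of `μ` and `ν` that lies on the separating hyperplane
    have hcomb : |ν ⬝ᵥ d V| • μ + |μ ⬝ᵥ d V| • ν ∈ V := by
      rw [hmem V hV, add_dotProduct, smul_dotProduct, smul_dotProduct, smul_eq_mul, smul_eq_mul]
      rcases mul_neg_iff.1 hneg with ⟨h1, h2⟩ | ⟨h1, h2⟩
      · rw [abs_of_pos h1, abs_of_neg h2]; ring
      · rw [abs_of_neg h1, abs_of_pos h2]; ring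
    obtain ⟨q, hq, hqne, hqV⟩ := hfib V hV (f μ) (hfT μ)
    have heq := hqV _ hcomb
    simp only [add_dotProduct, smul_dotProduct, smul_eq_mul] at heq
    have h1 := mul_lt_mul_of_pos_left (hlt μ hμ q hq hqne)
      (abs_pos.2 (right_ne_zero_of_mul hneg.ne))
    have h2 := mul_lt_mul_of_pos_left (hlt ν hν q hq (hμν ▸ hqne))
      (abs_pos.2 (left_ne_zero_of_mul hneg.ne))
    rw [← hμν] at h2
    linarith
  refine ⟨M.image f, ?_, ?_, ?_⟩
  · intro p hp
    obtain ⟨μ, _, rfl⟩ := Finset.mem_image.1 hp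
    exact hfT μ
  · rw [Finset.card_image_of_injOn hfinj, hcard]
  · intro p hp q hq hne hle
    obtain ⟨μ, hμ, rfl⟩ := Finset.mem_image.1 hp
    obtain ⟨ν, hν, rfl⟩ := Finset.mem_image.1 hq
    refine (hlt μ hμ _ (hfT ν) hne.symm).not_ge ?_
    refine Finset.sum_le_sum fun x _ => mul_le_mul_of_nonneg_left ?_ ((hM μ hμ).1 x).le
    exact Nat.cast_le.2 (hle x)

end Regions

/-! ### Supports of the minors of two equations -/

section Minor

variable {n k : ℕ}

theorem exists_opposite {h : FreeMonoid (Fin n) →* FreeMonoid (Fin k)}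
    {F : MvPolynomial (Fin n) ℚ} (hF : subst h F = 0) {p : Fin n →₀ ℕ} (hp : p ∈ F.support) :
    ∃ q ∈ F.support, coeff p F * coeff q F < 0 ∧
      ∀ v ∈ gammaSpan h, v ⬝ᵥ toRat p = v ⬝ᵥ toRat q := by
  by_contra! hno
  have h0 : ∑ q ∈ F.support with expo h q = expo h p, coeff p F * coeff q F = 0 := by
    rw [← Finset.mul_sum, ← coeff_subst, hF, coeff_zero, mul_zero]
  refine (Finset.sum_pos' (fun q hq => ?_) ⟨p, ?_, ?_⟩).ne' h0
  · rw [Finset.mem_filter] at hq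
    by_contra! hneg
    obtain ⟨v, hv, hne⟩ := hno q hq.1 hneg
    exact hne ((expo_eq_iff h p q).1 hq.2.symm v hv)
  · exact Finset.mem_filter.2 ⟨hp, rfl⟩
  · exact mul_self_pos.2 (mem_support_iff.1 hp)

theorem card_le_of_isAntichain_of_isChain {M P C : Finset (Fin n →₀ ℕ)}
    (hM : IsAntichain (· ≤ ·) (M : Set (Fin n →₀ ℕ)))
    (hC : IsChain (· ≤ ·) (C : Set (Fin n →₀ ℕ)))
    (hMC : ∀ m ∈ M, ∃ a ∈ P, ∃ c ∈ C, m = a + c) : M.card ≤ P.card := by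
  choose! f hfP g hgC hfg using hMC
  refine Finset.card_le_card_of_injOn f hfP fun m hm m' hm' hmm => ?_
  have h1 := hfg m hm
  have h2 := hfg m' hm'
  rw [← hmm] at h2
  rcases hC.total (hgC m hm) (hgC m' hm') with h | h
  · refine hM.eq hm hm' ?_
    rw [h1, h2]
    exact add_le_add_right h _
  · refine (hM.eq hm' hm ?_).symm
    rw [h1, h2]
    exact add_le_add_right h _

theorem mem_support_fox {E : Equation n} {x : Fin n} {p : Fin n →₀ ℕ}
    (hp : p ∈ (E.fox x).support) :
    p ∈ (fox x E.1).support ∨ p ∈ (fox x E.2).support := by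
  classical
  simpa using support_sub _ _ _ hp

theorem card_support_equation_fox_le (E : Equation n) (x : Fin n) :
    (E.fox x).support.card ≤ E.occ x := by
  classical
  exact (Finset.card_le_card (support_sub _ _ _)).trans ((Finset.card_union_le _ _).trans
    (add_le_add (card_support_fox_le x E.1) (card_support_fox_le x E.2)))

/-- The support of a minor is a union of translates of the four chains of exponents of Fox
derivatives of `E'`, by the exponents of the two Fox derivatives of `E`. -/
theorem card_le_of_isAntichain {E E' : Equation n} {x y : Fin n} {M : Finset (Fin n →₀ ℕ)}
    (hM : IsAntichain (· ≤ ·) (M : Set (Fin n →₀ ℕ)))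
    (hMF : M ⊆ (E.fox x * E'.fox y - E.fox y * E'.fox x).support) :
    M.card ≤ 2 * (E.occ x + E.occ y) := by
  classical
  let N (z : Fin n) (C : Finset (Fin n →₀ ℕ)) : Finset (Fin n →₀ ℕ) :=
    M.filter fun m => ∃ a ∈ (E.fox z).support, ∃ c ∈ C, m = a + c
  have hN : ∀ z t w, (N z (fox t w).support).card ≤ E.occ z := fun z t w =>
    (card_le_of_isAntichain_of_isChain (hM.subset (Finset.coe_subset.2 (Finset.filter_subset _ _)))
      (isChain_support_fox t w) fun m hm => (Finset.mem_filter.1 hm).2).trans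
      (card_support_equation_fox_le E z)
  have hsub : M ⊆ (N x (fox y E'.1).support ∪ N x (fox y E'.2).support) ∪
      (N y (fox x E'.1).support ∪ N y (fox x E'.2).support) := by
    intro m hm
    have hmul : ∀ z t, m ∈ (E.fox z * E'.fox t).support →
        m ∈ N z (fox t E'.1).support ∪ N z (fox t E'.2).support := by
      intro z t hmz
      obtain ⟨a, ha, c, hc, rfl⟩ := Finset.mem_add.1 (support_mul _ _ hmz)
      rcases mem_support_fox hc with h | h
      · exact Finset.mem_union_left _ (Finset.mem_filter.2 ⟨hm, a, ha, c, h, rfl⟩)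
      · exact Finset.mem_union_right _ (Finset.mem_filter.2 ⟨hm, a, ha, c, h, rfl⟩)
    exact Finset.mem_union.2
      ((Finset.mem_union.1 (support_sub _ _ _ (hMF hm))).imp (hmul x y) (hmul y x))
  have h1 := Finset.card_le_card hsub
  have h2 := Finset.card_union_le (N x (fox y E'.1).support ∪ N x (fox y E'.2).support)
    (N y (fox x E'.1).support ∪ N y (fox x E'.2).support)
  have h3 := Finset.card_union_le (N x (fox y E'.1).support) (N x (fox y E'.2).support)
  have h4 := Finset.card_union_le (N y (fox x E'.1).support) (N y (fox x E'.2).support)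
  have h5 := hN x y E'.1
  have h6 := hN x y E'.2
  have h7 := hN y x E'.1
  have h8 := hN y x E'.2
  omega

/-! ### Solutions that erase an unknown -/

theorem subst_fox_eq_zero_of_map_eq_one {h : FreeMonoid (Fin n) →* FreeMonoid (Fin k)}
    (hr : rank h + 1 = n) {E : Equation n} (hE : h E.1 = h E.2) {z : Fin n}
    (hz : h (FreeMonoid.of z) = 1) {x : Fin n} (hx : x ≠ z) : subst h (E.fox x) = 0 := by
  have := mul_eq_mul_of_orthogonal hr (B := Pi.single z 1) ((map_eq_iff h E).1 hE) (fun a => by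
    rw [Finset.sum_eq_single z (fun y _ hy => by simp [hy]) (by simp), hz, fox_one, mul_zero]) x z
  simpa [hx] using this

/-- If `E` has solutions of corank one that erase `z` and `w` respectively, then the derivatives of
`E` with respect to all other unknowns vanish. At a minimal exponent `p` of such a derivative, there
would be two other exponents, one differing from `p` at `z` only and one at `w` only, on the same
side of `E`; those are comparable, so one of them is below `p`. -/
theorem fox_eq_zero_of_map_eq_one {k' : ℕ} {h : FreeMonoid (Fin n) →* FreeMonoid (Fin k)}
    {h' : FreeMonoid (Fin n) →* FreeMonoid (Fin k')} (hr : rank h + 1 = n)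
    (hr' : rank h' + 1 = n) {E : Equation n} (hE : h E.1 = h E.2) (hE' : h' E.1 = h' E.2)
    {z w : Fin n} (hzw : z ≠ w) (hz : h (FreeMonoid.of z) = 1) (hw : h' (FreeMonoid.of w) = 1)
    {x : Fin n} (hxz : x ≠ z) (hxw : x ≠ w) : E.fox x = 0 := by
  by_contra hne
  obtain ⟨p, hp, hmin⟩ := (E.fox x).support.exists_minimal (support_nonempty.2 hne)
  obtain ⟨q, hq, hpq, hqV⟩ :=
    exists_opposite (subst_fox_eq_zero_of_map_eq_one hr hE hz hxz) hp
  obtain ⟨q', hq', hpq', hqV'⟩ :=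
    exists_opposite (subst_fox_eq_zero_of_map_eq_one hr' hE' hw hxw) hp
  have hqz : ∀ y, y ≠ z → p y = q y := by
    intro y hy
    have := hqV (Pi.single y 1) ((mem_gammaSpan_iff_of_map_eq_one hr hz _).2 (by simp [hy.symm]))
    simpa [toRat] using this
  have hqw : ∀ y, y ≠ w → p y = q' y := by
    intro y hy
    have := hqV' (Pi.single y 1)
      ((mem_gammaSpan_iff_of_map_eq_one hr' hw _).2 (by simp [hy.symm]))
    simpa [toRat] using this
  have hnot : ∀ {r}, r ∈ (E.fox x).support → coeff p (E.fox x) * coeff r (E.fox x) < 0 →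
      ¬ r ≤ p := by
    intro r hr hneg hle
    rw [le_antisymm hle (hmin hr hle)] at hneg
    exact hneg.not_ge (mul_self_nonneg _)
  have hcomp : q ≤ q' ∨ q' ≤ q := by
    have hside : ∀ r ∈ (E.fox x).support,
        (0 < coeff r (E.fox x) → r ∈ (fox x E.1).support) ∧
        (coeff r (E.fox x) < 0 → r ∈ (fox x E.2).support) := by
      intro r _
      rw [Equation.fox, coeff_sub, mem_support_iff, mem_support_iff]
      have h1 := coeff_fox_nonneg x E.1 r
      have h2 := coeff_fox_nonneg x E.2 r
      exact ⟨fun h => by linarith, fun h => by linarith⟩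
    rcases mul_neg_iff.1 hpq with ⟨h1, h2⟩ | ⟨h1, h2⟩
    · have h3 : coeff q' (E.fox x) < 0 := by
        rcases mul_neg_iff.1 hpq' with h | h
        · exact h.2
        · exact absurd h.1 h1.not_gt
      exact (isChain_support_fox x E.2).total ((hside q hq).2 h2) ((hside q' hq').2 h3)
    · have h3 : 0 < coeff q' (E.fox x) := by
        rcases mul_neg_iff.1 hpq' with h | h
        · exact absurd h.1 h1.not_gt
        · exact h.2
      exact (isChain_support_fox x E.1).total ((hside q hq).1 h2) ((hside q' hq').1 h3)
  rcases hcomp with hle | hle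
  · refine hnot hq hpq fun y => ?_
    by_cases hy : y = z
    · rw [hy, hqw z hzw]
      exact hle z
    · exact (hqz y hy).ge
  · refine hnot hq' hpq' fun y => ?_
    by_cases hy : y = w
    · rw [hy, hqz w hzw.symm]
      exact hle w
    · exact (hqw y hy).ge

theorem fox_mul_X_sub_one_of_map_eq_one {k' : ℕ} {h : FreeMonoid (Fin n) →* FreeMonoid (Fin k)}
    {h' : FreeMonoid (Fin n) →* FreeMonoid (Fin k')} (hr : rank h + 1 = n)
    (hr' : rank h' + 1 = n) {E : Equation n} (hE : h E.1 = h E.2) (hE' : h' E.1 = h' E.2)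
    {z w : Fin n} (hzw : z ≠ w) (hz : h (FreeMonoid.of z) = 1) (hw : h' (FreeMonoid.of w) = 1) :
    E.fox z * (X z - 1) + E.fox w * (X w - 1) = 0 := by
  have hbal : mono E.1 = mono E.2 := by
    have hocc : ∀ x, eval 1 (E.fox x) = 0 := by
      intro x
      by_cases hx : x = z
      · rw [← eval_one_subst h', subst_fox_eq_zero_of_map_eq_one hr' hE' hw (hx ▸ hzw), map_zero]
      · rw [← eval_one_subst h, subst_fox_eq_zero_of_map_eq_one hr hE hz hx, map_zero]
    have : parikh E.1 = parikh E.2 := by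
      ext x
      have := hocc x
      rw [Equation.fox, map_sub, eval_one_fox, eval_one_fox, sub_eq_zero] at this
      rw [parikh_apply, parikh_apply]
      exact_mod_cast this
    rw [mono, mono, this]
  have hsum : ∑ x, E.fox x * (X x - 1) = 0 := by
    have : ∑ x, E.fox x * (X x - 1) =
        ∑ x, fox x E.1 * (X x - 1) - ∑ x, fox x E.2 * (X x - 1) := by
      rw [← Finset.sum_sub_distrib]
      exact Finset.sum_congr rfl fun x _ => sub_mul _ _ _
    rw [this, sum_fox_mul_X_sub_one, sum_fox_mul_X_sub_one, hbal, sub_self]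
  rwa [Fintype.sum_eq_add z w hzw fun x hx => by
    rw [fox_eq_zero_of_map_eq_one hr hr' hE hE' hzw hz hw hx.1 hx.2, zero_mul]] at hsum

/-- Two equations with common solutions of corank one that erase `z` and `w` respectively are
proportional. -/
theorem minor_eq_zero_of_map_eq_one {k' : ℕ} {h : FreeMonoid (Fin n) →* FreeMonoid (Fin k)}
    {h' : FreeMonoid (Fin n) →* FreeMonoid (Fin k')} (hr : rank h + 1 = n)
    (hr' : rank h' + 1 = n) {E E' : Equation n} (h1 : h E.1 = h E.2) (h1' : h' E.1 = h' E.2)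
    (h2 : h E'.1 = h E'.2) (h2' : h' E'.1 = h' E'.2)
    {z w : Fin n} (hzw : z ≠ w) (hz : h (FreeMonoid.of z) = 1) (hw : h' (FreeMonoid.of w) = 1)
    (x y : Fin n) : E.fox x * E'.fox y - E.fox y * E'.fox x = 0 := by
  have hA := fox_mul_X_sub_one_of_map_eq_one hr hr' h1 h1' hzw hz hw
  have hB := fox_mul_X_sub_one_of_map_eq_one hr hr' h2 h2' hzw hz hw
  have hX : (X w - 1 : MvPolynomial (Fin n) ℚ) ≠ 0 := by
    intro h0
    have := congrArg (eval 0) h0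
    simp at this
  have key : E.fox z * E'.fox w - E.fox w * E'.fox z = 0 := by
    refine (mul_eq_zero.1 ?_).resolve_left hX
    linear_combination E.fox z * hB - E'.fox z * hA
  have hA0 : ∀ x, x ≠ z → x ≠ w → E.fox x = 0 := fun x =>
    fox_eq_zero_of_map_eq_one hr hr' h1 h1' hzw hz hw
  have hB0 : ∀ x, x ≠ z → x ≠ w → E'.fox x = 0 := fun x =>
    fox_eq_zero_of_map_eq_one hr hr' h2 h2' hzw hz hw
  by_cases hx : x ≠ z ∧ x ≠ w
  · rw [hA0 x hx.1 hx.2, hB0 x hx.1 hx.2]; ring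
  by_cases hy : y ≠ z ∧ y ≠ w
  · rw [hA0 y hy.1 hy.2, hB0 y hy.1 hy.2]; ring
  have hx' : x = z ∨ x = w := by tauto
  have hy' : y = z ∨ y = w := by tauto
  rcases hx' with rfl | rfl <;> rcases hy' with rfl | rfl
  · ring
  · exact key
  · linear_combination -key
  · ring

/-! ### The number of hyperplanes -/

theorem exists_pos_mem_gammaSpan {h : FreeMonoid (Fin n) →* FreeMonoid (Fin k)}
    (hh : ∀ x, h (FreeMonoid.of x) ≠ 1) : ∃ c ∈ gammaSpan h, ∀ x, 0 < c x := by
  refine ⟨∑ a, gamma h a, Submodule.sum_mem _ fun a _ => gamma_mem_gammaSpan h a, fun x => ?_⟩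
  rw [Finset.sum_apply]
  obtain ⟨a, ha⟩ := List.exists_mem_of_ne_nil _ (hh x)
  refine Finset.sum_pos' (fun b _ => Nat.cast_nonneg _) ⟨a, Finset.mem_univ a, ?_⟩
  exact Nat.cast_pos.2 (List.count_pos_iff.2 ha)

/-- The solutions of corank one that two equations have in common have few spans, unless the two
equations are proportional. -/
theorem card_le_of_minor_ne_zero {E E' : Equation n} (S : Finset (Submodule ℚ (Fin n → ℚ)))
    (hS : ∀ V ∈ S, ∃ (k : ℕ) (h : FreeMonoid (Fin n) →* FreeMonoid (Fin k)),
      rank h + 1 = n ∧ gammaSpan h = V ∧ h E.1 = h E.2 ∧ h E'.1 = h E'.2)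
    {x y : Fin n} (hxy : E.fox x * E'.fox y - E.fox y * E'.fox x ≠ 0) :
    S.card ≤ 2 * (E.occ x + E.occ y) := by
  classical
  let P : Submodule ℚ (Fin n → ℚ) → Prop := fun V => ∃ c ∈ V, ∀ x, 0 < c x
  have hspecial : (S.filter fun V => ¬ P V).card ≤ 1 := by
    refine Finset.card_le_one.2 fun V hV V' hV' => ?_
    rw [Finset.mem_filter] at hV hV'
    obtain ⟨k, h, hr, rfl, h1, h2⟩ := hS V hV.1
    obtain ⟨k', h', hr', rfl, h1', h2'⟩ := hS V' hV'.1
    obtain ⟨z, hz⟩ : ∃ z, h (FreeMonoid.of z) = 1 := by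
      by_contra! hno
      exact hV.2 (exists_pos_mem_gammaSpan hno)
    obtain ⟨w, hw⟩ : ∃ w, h' (FreeMonoid.of w) = 1 := by
      by_contra! hno
      exact hV'.2 (exists_pos_mem_gammaSpan hno)
    by_cases hzw : z = w
    · subst hzw
      ext v
      rw [mem_gammaSpan_iff_of_map_eq_one hr hz, mem_gammaSpan_iff_of_map_eq_one hr' hw]
    · exact absurd (minor_eq_zero_of_map_eq_one hr hr' h1 h1' h2 h2' hzw hz hw x y) hxy
  obtain ⟨M, hMF, hcard, hM⟩ := exists_antichain
    (E.fox x * E'.fox y - E.fox y * E'.fox x).support (support_nonempty.2 hxy) (S.filter P)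
    (fun V hV => by
      obtain ⟨k, h, hr, rfl, -⟩ := hS V (Finset.mem_filter.1 hV).1
      exact hr)
    (fun V hV => (Finset.mem_filter.1 hV).2)
    (fun V hV p hp => by
      obtain ⟨k, h, hr, rfl, h1, h2⟩ := hS V (Finset.mem_filter.1 hV).1
      obtain ⟨q, hq, hneg, hv⟩ := exists_opposite (subst_minor_eq_zero hr h1 h2 x y) hp
      refine ⟨q, hq, ?_, hv⟩
      rintro rfl
      exact hneg.not_ge (mul_self_nonneg _))
  have h1 := card_le_of_isAntichain hM hMF
  have h2 := Finset.card_filter_add_card_filter_not (s := S) P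
  omega

theorem one_lt_of_map_ne {h : FreeMonoid (Fin n) →* FreeMonoid (Fin k)} (hr : rank h + 1 = n)
    {E : Equation n} (hE : h E.1 ≠ h E.2) : 1 < n := by
  by_contra hn
  have h0 : gammaSpan h = ⊥ := Submodule.finrank_eq_zero.1 (show rank h = 0 by omega)
  have h1 : h = 1 := FreeMonoid.hom_eq fun x => by
    by_contra hx
    obtain ⟨a, ha⟩ := List.exists_mem_of_ne_nil _ hx
    have hmem := gamma_mem_gammaSpan h a
    rw [h0, Submodule.mem_bot] at hmem
    have h2 : occ a (h (FreeMonoid.of x)) = 0 :=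
      Nat.cast_injective (R := ℚ) ((congrFun hmem x).trans Nat.cast_zero.symm)
    exact (List.count_pos_iff.2 ha).ne' h2
  rw [h1] at hE
  exact hE rfl

theorem occ_add_occ_le_length {α : Type} [DecidableEq α] {x y : α} (hxy : x ≠ y)
    (w : FreeMonoid α) : occ x w + occ y w ≤ w.length := by
  induction w using FreeMonoid.inductionOn' with
  | one => simp [occ]
  | of_mul b w ih =>
    simp only [occ, FreeMonoid.toList_of_mul, List.count_cons, FreeMonoid.length_mul,
      FreeMonoid.length_of, beq_iff_eq] at ih ⊢
    split_ifs with h1 h2 <;> first | omega | exact absurd (h1.symm.trans h2) hxy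

theorem Equation.occ_add_occ_le_size {x y : Fin n} (hxy : x ≠ y) (E : Equation n) :
    E.occ x + E.occ y ≤ E.size := by
  have h1 := occ_add_occ_le_length hxy E.1
  have h2 := occ_add_occ_le_length hxy E.2
  simp only [Equation.occ, Equation.size]
  omega

end Minor

/-! ### Strongly independent systems -/

section System

variable {n m : ℕ}

theorem StronglyIndependent.exists_solution {E : Fin m → Equation n} (hE : Function.Injective E)
    (hT : StronglyIndependent (Set.range E)) (i : Fin m) :
    ∃ (k : ℕ) (h : FreeMonoid (Fin n) →* FreeMonoid (Fin k)), rank h + 1 = n ∧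
      (∀ j, j ≠ i → h (E j).1 = h (E j).2) ∧ h (E i).1 ≠ h (E i).2 := by
  obtain ⟨k, h, hsol, hr, hno⟩ := hT (Set.range E \ {E i})
    ⟨Set.sdiff_subset, fun hsub => (hsub ⟨i, rfl⟩).2 rfl⟩
  have hj : ∀ j, j ≠ i → h (E j).1 = h (E j).2 := fun j hj =>
    hsol _ ⟨⟨j, rfl⟩, fun heq => hj (hE heq)⟩
  refine ⟨k, h, hr, hj, fun hi => hno ?_⟩
  rintro _ ⟨j, rfl⟩
  by_cases hji : j = i
  · rw [hji, hi]
  · exact hj j hji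

/-- A bound for the number of spans of the common solutions of corank one of two equations that are
told apart by a morphism of corank one. -/
theorem exists_card_le {k : ℕ} {h : FreeMonoid (Fin n) →* FreeMonoid (Fin k)}
    (hr : rank h + 1 = n) {E E' : Equation n} (hE : E.1 ≠ E.2) (h1 : h E.1 = h E.2)
    (h2 : h E'.1 ≠ h E'.2) :
    ∃ x y : Fin n, x < y ∧ ∀ S : Finset (Submodule ℚ (Fin n → ℚ)),
      (∀ V ∈ S, ∃ (k : ℕ) (h : FreeMonoid (Fin n) →* FreeMonoid (Fin k)),
        rank h + 1 = n ∧ gammaSpan h = V ∧ h E.1 = h E.2 ∧ h E'.1 = h E'.2) →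
      S.card ≤ 2 * (E.occ x + E.occ y) ∧ S.card ≤ E.size + E'.size := by
  obtain ⟨x, y, hxy, hF⟩ : ∃ x y : Fin n, x < y ∧
      E.fox x * E'.fox y - E.fox y * E'.fox x ≠ 0 := by
    by_contra! hno
    refine h2 (map_eq_of_proportional hr hE h1 fun x y => ?_)
    rcases lt_trichotomy x y with hlt | rfl | hlt
    · rw [hno x y hlt, map_zero]
    · rw [sub_self, map_zero]
    · rw [← neg_sub, map_neg, hno y x hlt, map_zero, neg_zero]
  have hF' : E'.fox x * E.fox y - E'.fox y * E.fox x ≠ 0 := by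
    intro h0
    refine hF ?_
    linear_combination -h0
  refine ⟨x, y, hxy, fun S hS => ?_⟩
  have h3 := card_le_of_minor_ne_zero S hS hF
  have h4 := card_le_of_minor_ne_zero S (fun V hV => by
    obtain ⟨k, h, hr, hV, h1, h2⟩ := hS V hV
    exact ⟨k, h, hr, hV, h2, h1⟩) hF'
  have h5 := E.occ_add_occ_le_size hxy.ne
  have h6 := E'.occ_add_occ_le_size hxy.ne
  exact ⟨h3, by omega⟩

end System
end WordEq

theorem mainTheorem2 {n m : ℕ} (E : Fin m → WordEq.Equation n) (hE : Function.Injective E)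
    (hm : 0 < m) (hT : WordEq.StronglyIndependent (Set.range E)) :
    ((∀ h2 : 1 < m, m ≤ (E ⟨0, hm⟩).size + (E ⟨1, h2⟩).size + 2) ∧
      ∃ k l : Fin n, k < l ∧ m ≤ 2 * ((E ⟨0, hm⟩).occ k + (E ⟨0, hm⟩).occ l) + 2) ∧
    (WordEq.HasSolutionOfCorank1 (Set.range E) →
      (∀ h2 : 1 < m, m ≤ (E ⟨0, hm⟩).size + (E ⟨1, h2⟩).size + 1) ∧
        ∃ k l : Fin n, k < l ∧ m ≤ 2 * ((E ⟨0, hm⟩).occ k + (E ⟨0, hm⟩).occ l) + 1) := by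
  classical
  choose k h hr hsol hno using fun i => hT.exists_solution hE i
  have hne : ∀ i, (E i).1 ≠ (E i).2 := fun i heq => hno i (by rw [heq])
  by_cases h2 : 1 < m
  swap
  · have hn := WordEq.one_lt_of_map_ne (hr ⟨0, hm⟩) (hno ⟨0, hm⟩)
    have hlt : (⟨0, by omega⟩ : Fin n) < ⟨1, hn⟩ := Fin.mk_lt_mk.2 one_pos
    exact ⟨⟨fun h => absurd h h2, _, _, hlt, by omega⟩,
      fun _ => ⟨fun h => absurd h h2, _, _, hlt, by omega⟩⟩
  obtain ⟨x, y, hxy, hbound⟩ := WordEq.exists_card_le (hr ⟨1, h2⟩) (hne ⟨0, hm⟩)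
    (hsol ⟨1, h2⟩ ⟨0, hm⟩ (by simp)) (hno ⟨1, h2⟩)
  -- the indices of the equations other than the first two
  let I : Finset (Fin m) := Finset.univ \ {⟨0, hm⟩, ⟨1, h2⟩}
  have hIcard : I.card + 2 = m := by
    have := Finset.card_sdiff_add_card_eq_card
      (Finset.subset_univ ({⟨0, hm⟩, ⟨1, h2⟩} : Finset (Fin m)))
    rwa [Finset.card_pair (by simp), Finset.card_univ, Fintype.card_fin] at this
  have hI : ∀ i ∈ I, (⟨0, hm⟩ : Fin m) ≠ i ∧ (⟨1, h2⟩ : Fin m) ≠ i := by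
    intro i hi
    simp only [I, Finset.mem_sdiff, Finset.mem_univ, true_and, Finset.mem_insert,
      Finset.mem_singleton, not_or] at hi
    exact ⟨Ne.symm hi.1, Ne.symm hi.2⟩
  let S := I.image fun i => WordEq.gammaSpan (h i)
  have hScard : S.card = I.card := Finset.card_image_of_injOn fun i hi j hj hij => by
    by_contra hne'
    exact hno j (WordEq.map_eq_of_gammaSpan_eq (hr i) (hr j) hij (hne ⟨0, hm⟩)
      (hsol i _ (hI i hi).1) (hsol i j (Ne.symm hne')) (hsol j _ (hI j hj).1))
  have hS : ∀ V ∈ S, ∃ (k : ℕ) (h : FreeMonoid (Fin n) →* FreeMonoid (Fin k)),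
      WordEq.rank h + 1 = n ∧ WordEq.gammaSpan h = V ∧
        h (E ⟨0, hm⟩).1 = h (E ⟨0, hm⟩).2 ∧ h (E ⟨1, h2⟩).1 = h (E ⟨1, h2⟩).2 := by
    intro V hV
    obtain ⟨i, hi, rfl⟩ := Finset.mem_image.1 hV
    exact ⟨k i, h i, hr i, rfl, hsol i _ (hI i hi).1, hsol i _ (hI i hi).2⟩
  refine ⟨?_, ?_⟩
  · obtain ⟨h3, h4⟩ := hbound S hS
    exact ⟨fun _ => by omega, x, y, hxy, by omega⟩
  · rintro ⟨k', h', hsol', hr'⟩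
    have hall : ∀ i, h' (E i).1 = h' (E i).2 := fun i => hsol' _ ⟨i, rfl⟩
    have hnot : WordEq.gammaSpan h' ∉ S := by
      intro hmem
      obtain ⟨i, hi, heq⟩ := Finset.mem_image.1 hmem
      exact hno i (WordEq.map_eq_of_gammaSpan_eq hr' (hr i) heq.symm (hne ⟨0, hm⟩)
        (hall _) (hall i) (hsol i _ (hI i hi).1))
    obtain ⟨h3, h4⟩ := hbound (insert (WordEq.gammaSpan h') S)
      ((Finset.forall_mem_insert _ _ _).2 ⟨⟨k', h', hr', rfl, hall _, hall _⟩, hS⟩)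
    rw [Finset.card_insert_of_notMem hnot] at h3 h4
    exact ⟨fun _ => by omega, x, y, hxy, by omega⟩
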